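/- Let $n\ge 3$, let $g=\sum_i dx_i^2$ be the Euclidean metric on $\mathbb R^n$, and let $\varphi:\mathbb R^n\to\mathbb R$ be a smooth function such that $0<|\varphi(x)|\le c$ for all $x\in\mathbb R^n$, for some constant $c$. (1) If $\varphi=\varphi(\xi)$ is a function of $\xi=\sum_{i=1}^n\alpha_i x_i$ for some $\alpha\in\mathbb R^n$, then the Riemannian metric $\bar g=\frac{1}{\varphi^2}\,g$ on $\mathbb R^n$ is complete. (2) If $\varphi=\varphi(\xi)$ is as in (1), and $(F^m,g_F)$ is a complete Ricci-flat (smooth, Hausdorff) Riemannian manifold, then the warped product metric $\tilde g=\bar g+f^2 g_F$ on $\mathbb R^n\times F$, where $\bar g=\frac1{\varphi^2}g$ and $f=\frac1\varphi$, is complete. (3) If $\varphi=\varphi(r)$ is a function of $r=\sum_{i=1}^n x_i^2$, then the Riemannian metric $\bar g=\frac1{\varphi^2}\,g$ on $\mathbb R^n$ is complete. Here a Riemannian metric is called complete if every Cauchy sequence of its Riemannian distance (the infimum of lengths of $C^1$ paths) converges. -/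

import Mathlib

set_option linter.unusedSectionVars false

open Bundle Bornology Filter Manifold
open scoped ContDiff Topology ENNReal

noncomputable section

namespace RicciAlmostSoliton

/-- A smooth Riemannian metric on the manifold `M`. -/
abbrev RiemMetric {E : Type*} [NormedAddCommGroup E] [NormedSpace ℝ E]
    {H : Type*} [TopologicalSpace H] (I : ModelWithCorners ℝ E H)
    (M : Type*) [TopologicalSpace M] [ChartedSpace H M] [IsManifold I ∞ M] :=
  ContMDiffRiemannianMetric I ∞ E (fun x : M => TangentSpace I x)

section General

variable {E : Type*} [NormedAddCommGroup E] [NormedSpace ℝ E]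
  {H : Type*} [TopologicalSpace H] {I : ModelWithCorners ℝ E H}
  {M : Type*} [TopologicalSpace M] [ChartedSpace H M] [IsManifold I ∞ M]
  {E' : Type*} [NormedAddCommGroup E'] [NormedSpace ℝ E']
  {H' : Type*} [TopologicalSpace H'] {I' : ModelWithCorners ℝ E' H'}
  {M' : Type*} [TopologicalSpace M'] [ChartedSpace H' M'] [IsManifold I' ∞ M']

/-- The Riemannian distance of the metric `g`: the infimum of the `g`-lengths of the `C^1` paths
from `x` to `y` (it is `∞` if `x` and `y` lie in different components). -/
def RiemMetric.distance (g : RiemMetric I M) (x y : M) : ℝ≥0∞ :=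
  letI : RiemannianBundle (fun x : M => TangentSpace I x) := ⟨g.toRiemannianMetric⟩
  riemannianEDist I x y

/-- The metric `g` is complete: every sequence that is Cauchy for the Riemannian distance of `g`
converges for that distance. -/
def RiemMetric.IsComplete (g : RiemMetric I M) : Prop :=
  ∀ u : ℕ → M,
    (∀ ε : ℝ≥0∞, 0 < ε → ∃ N : ℕ, ∀ k ≥ N, ∀ l ≥ N, g.distance (u k) (u l) < ε) →
    ∃ x : M, Tendsto (fun k => g.distance (u k) x) atTop (𝓝 0)

/-- The pullback `q^* g` as a field of bilinear forms. -/
def pullbackForm (g : RiemMetric I' M') (q : M → M') (p : M) :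
    TangentSpace I p →L[ℝ] TangentSpace I p →L[ℝ] ℝ :=
  (ContinuousLinearMap.precomp ℝ (mfderiv I I' q p)) ∘L (g.inner (q p)) ∘L (mfderiv I I' q p)

@[simp] theorem pullbackForm_apply (g : RiemMetric I' M') (q : M → M') (p : M)
    (v w : TangentSpace I p) :
    pullbackForm g q p v w = g.inner (q p) (mfderiv I I' q p v) (mfderiv I I' q p w) := rfl

theorem pullbackForm_nonneg (g : RiemMetric I' M') (q : M → M') (p : M) (v : TangentSpace I p) :
    0 ≤ pullbackForm (I := I) g q p v v := by
  rw [pullbackForm_apply]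
  rcases eq_or_ne (mfderiv I I' q p v) 0 with h | h
  · simp [h]
  · exact (g.pos _ _ h).le

set_option synthInstance.maxHeartbeats 200000 in
set_option maxHeartbeats 1000000 in
theorem contMDiffAt_congruence {G : M → E' →L[ℝ] E' →L[ℝ] ℝ} {L : M → E →L[ℝ] E'} {p : M}
    (hG : ContMDiffAt I 𝓘(ℝ, E' →L[ℝ] E' →L[ℝ] ℝ) ∞ G p)
    (hL : ContMDiffAt I 𝓘(ℝ, E →L[ℝ] E') ∞ L p) :
    ContMDiffAt I 𝓘(ℝ, E →L[ℝ] E →L[ℝ] ℝ) ∞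
      (fun x => (ContinuousLinearMap.precomp ℝ (L x)) ∘L (G x) ∘L (L x)) p := by
  have hT : ContDiff ℝ ∞ (fun z : (E' →L[ℝ] E' →L[ℝ] ℝ) × (E →L[ℝ] E') =>
      ((ContinuousLinearMap.compL ℝ E E' ℝ).flip z.2) ∘L z.1 ∘L z.2) :=
    ((ContinuousLinearMap.compL ℝ E E' ℝ).flip.contDiff.comp contDiff_snd).clm_comp
      (contDiff_fst.clm_comp contDiff_snd)
  exact hT.contDiffAt.contMDiffAt.comp p (hG.prodMk_space hL)

theorem contMDiff_pullbackForm (g : RiemMetric I' M') {q : M → M'} (hq : ContMDiff I I' ∞ q) :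
    ContMDiff I (I.prod 𝓘(ℝ, E →L[ℝ] E →L[ℝ] ℝ)) ∞
      (fun p : M => TotalSpace.mk' (E →L[ℝ] E →L[ℝ] ℝ) p (pullbackForm (I := I) g q p)) := by
  intro p₀
  rw [contMDiffAt_hom_bundle]
  refine ⟨contMDiffAt_id, ?_⟩
  have hG := ((contMDiffAt_hom_bundle _).1 (g.contMDiff (q p₀))).2
  have hGq := hG.comp p₀ (hq p₀)
  have hL := (hq p₀).mfderiv_const (m := ∞) (by simp)
  have hb : (fun x => (ContinuousLinearMap.precomp ℝ
        (inTangentCoordinates I I' id q (fun x => mfderiv I I' q x) p₀ x)) ∘L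
      (ContinuousLinearMap.inCoordinates E' (fun x : M' => TangentSpace I' x) (E' →L[ℝ] ℝ)
        (fun x : M' => TangentSpace I' x →L[ℝ] ℝ) (q p₀) (q x) (q p₀) (q x) (g.inner (q x))) ∘L
      (inTangentCoordinates I I' id q (fun x => mfderiv I I' q x) p₀ x)) =ᶠ[𝓝 p₀]
      (fun x => ContinuousLinearMap.inCoordinates E (fun x : M => TangentSpace I x) (E →L[ℝ] ℝ)
        (fun x : M => TangentSpace I x →L[ℝ] ℝ) p₀ x p₀ x (pullbackForm (I := I) g q x)) := by
    have h1 : ∀ᶠ x in 𝓝 p₀, x ∈ (trivializationAt E (fun x : M => TangentSpace I x) p₀).baseSet :=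
      (trivializationAt E (fun x : M => TangentSpace I x) p₀).open_baseSet.mem_nhds
        (FiberBundle.mem_baseSet_trivializationAt' p₀)
    have h2 : ∀ᶠ x in 𝓝 p₀,
        q x ∈ (trivializationAt E' (fun x : M' => TangentSpace I' x) (q p₀)).baseSet :=
      (hq p₀).continuousAt.eventually
        ((trivializationAt E' (fun x : M' => TangentSpace I' x) (q p₀)).open_baseSet.mem_nhds
        (FiberBundle.mem_baseSet_trivializationAt' (q p₀)))
    filter_upwards [h1, h2] with x hx hx'
    ext v w
    rw [inCoordinates_apply_eq₂ hx hx (by simp)]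
    simp only [inTangentCoordinates, ContinuousLinearMap.comp_apply,
      ContinuousLinearMap.precomp_apply]
    rw [inCoordinates_apply_eq₂ hx' hx' (by simp)]
    rw [ContinuousLinearMap.inCoordinates_eq (x₀ := id p₀) (x := id x) hx hx']
    simp [pullbackForm_apply, Trivialization.symm_apply_apply_mk _ hx']
  refine ContMDiffAt.congr_of_eventuallyEq ?_ hb.symm
  exact contMDiffAt_congruence hGq hL

theorem contMDiff_add_smul_form {A B : ∀ p : M, TangentSpace I p →L[ℝ] TangentSpace I p →L[ℝ] ℝ}
    {r : M → ℝ}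
    (hA : ContMDiff I (I.prod 𝓘(ℝ, E →L[ℝ] E →L[ℝ] ℝ)) ∞
      (fun p : M => TotalSpace.mk' (E →L[ℝ] E →L[ℝ] ℝ) p (A p)))
    (hr : ContMDiff I 𝓘(ℝ, ℝ) ∞ r)
    (hB : ContMDiff I (I.prod 𝓘(ℝ, E →L[ℝ] E →L[ℝ] ℝ)) ∞
      (fun p : M => TotalSpace.mk' (E →L[ℝ] E →L[ℝ] ℝ) p (B p))) :
    ContMDiff I (I.prod 𝓘(ℝ, E →L[ℝ] E →L[ℝ] ℝ)) ∞
      (fun p : M => TotalSpace.mk' (E →L[ℝ] E →L[ℝ] ℝ) p (A p + r p • B p)) :=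
  hA.add_section (hr.smul_section hB)

theorem isVonNBounded_prod {X Y : Type*} [AddCommGroup X] [Module ℝ X] [TopologicalSpace X]
    [AddCommGroup Y] [Module ℝ Y] [TopologicalSpace Y] {S : Set X} {T : Set Y}
    (hS : IsVonNBounded ℝ S) (hT : IsVonNBounded ℝ T) : IsVonNBounded ℝ (S ×ˢ T) := by
  intro V hV
  rw [Prod.zero_eq_mk, nhds_prod_eq, Filter.mem_prod_iff] at hV
  obtain ⟨a, ha, b, hb, hab⟩ := hV
  filter_upwards [hS ha, hT hb] with c hc hd
  rintro ⟨x, y⟩ ⟨hx, hy⟩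
  obtain ⟨x', hx', rfl⟩ := hc hx
  obtain ⟨y', hy', rfl⟩ := hd hy
  exact ⟨(x', y'), hab ⟨hx', hy'⟩, rfl⟩

theorem isVonNBounded_lt (g : RiemMetric I M) (p : M) {r : ℝ} (hr : 0 < r) :
    IsVonNBounded ℝ {v : TangentSpace I p | r * g.inner p v v < 1} := by
  have hs : √r ≠ 0 := (Real.sqrt_pos.2 hr).ne'
  have h := (g.isVonNBounded p).image ((√r)⁻¹ • ContinuousLinearMap.id ℝ (TangentSpace I p))
  refine h.subset ?_
  intro v hv
  refine ⟨√r • v, ?_, ?_⟩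
  · have : √r * (√r * g.inner p v v) = r * g.inner p v v := by
      rw [← mul_assoc, Real.mul_self_sqrt hr.le]
    simpa [this] using hv
  · simp [smul_smul, hs]

/-- The conformal metric `φ⁻² g`. -/
def conformalMetric (g : RiemMetric I M) (φ : M → ℝ) (hφ : ContMDiff I 𝓘(ℝ, ℝ) ∞ φ)
    (hφ₀ : ∀ p, φ p ≠ 0) : RiemMetric I M where
  inner p := (1 / φ p ^ 2) • g.inner p
  symm p v w := by simp [g.symm p v w]
  pos p v hv := by
    have h1 := g.pos p v hv
    have h2 : 0 < φ p ^ 2 := by have := hφ₀ p; positivity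
    simp only [smul_apply, smul_eq_mul]
    positivity
  isVonNBounded p := by
    have h2 : 0 < φ p ^ 2 := by have := hφ₀ p; positivity
    have h := isVonNBounded_lt g p (one_div_pos.2 h2)
    simpa using h
  contMDiff := by
    have h : ContMDiff I 𝓘(ℝ, ℝ) ∞ (fun p => 1 / φ p ^ 2) := by
      have h2 : ContMDiff I 𝓘(ℝ, ℝ) ∞ (fun p => (φ p ^ 2)⁻¹) :=
        (hφ.pow 2).inv₀ (fun p => pow_ne_zero 2 (hφ₀ p))
      simpa using h2
    exact h.smul_section g.contMDiff

/-- The warped product metric `π^* g + (f ∘ π)² σ^* g'` on `M × M'`, where `π`, `σ` are the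
projections to the base `M` and the fibre `M'`. -/
def warpedProductMetric (g : RiemMetric I M) (g' : RiemMetric I' M') (f : M → ℝ)
    (hf : ContMDiff I 𝓘(ℝ, ℝ) ∞ f) (hf₀ : ∀ p, f p ≠ 0) :
    RiemMetric (I.prod I') (M × M') where
  inner p := pullbackForm g Prod.fst p + (f p.1 ^ 2) • pullbackForm g' Prod.snd p
  symm p v w := by
    simp only [add_apply, smul_apply, pullbackForm_apply]
    rw [g.symm, g'.symm]
  pos p v hv := by
    have h2 : 0 < f p.1 ^ 2 := by have := hf₀ p.1; positivity
    have h3 := pullbackForm_nonneg (I := I.prod I') g Prod.fst p v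
    have h4 := pullbackForm_nonneg (I := I.prod I') g' Prod.snd p v
    simp only [add_apply, smul_apply, smul_eq_mul]
    by_cases hv1 : mfderiv (I.prod I') I Prod.fst p v = 0
    · have hv2 : mfderiv (I.prod I') I' Prod.snd p v ≠ 0 := by
        intro hv2
        rw [mfderiv_fst] at hv1
        rw [mfderiv_snd] at hv2
        exact hv (Prod.ext hv1 hv2)
      have h5 : 0 < pullbackForm (I := I.prod I') g' Prod.snd p v v := g'.pos _ _ hv2
      positivity
    · have h5 : 0 < pullbackForm (I := I.prod I') g Prod.fst p v v := g.pos _ _ hv1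
      positivity
  isVonNBounded p := by
    have h2 : 0 < f p.1 ^ 2 := by have := hf₀ p.1; positivity
    have hA := g.isVonNBounded p.1
    have hB := isVonNBounded_lt g' p.2 h2
    refine (isVonNBounded_prod hA hB).subset ?_
    intro (v : TangentSpace (I.prod I') p) hv
    have h3 := pullbackForm_nonneg (I := I.prod I') g Prod.fst p v
    have h4 := pullbackForm_nonneg (I := I.prod I') g' Prod.snd p v
    have hv' : pullbackForm (I := I.prod I') g Prod.fst p v v +
      f p.1 ^ 2 * pullbackForm (I := I.prod I') g' Prod.snd p v v < 1 := hv
    have e1 : pullbackForm (I := I.prod I') g Prod.fst p v v =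
        g.inner p.1 (Prod.fst (α := E) (β := E') v) (Prod.fst (α := E) (β := E') v) :=
      congrArg (fun L : TangentSpace (I.prod I') p →L[ℝ] TangentSpace I p.1 =>
        g.inner p.1 (L v) (L v)) mfderiv_fst
    have e2 : pullbackForm (I := I.prod I') g' Prod.snd p v v =
        g'.inner p.2 (Prod.snd (α := E) (β := E') v) (Prod.snd (α := E) (β := E') v) :=
      congrArg (fun L : TangentSpace (I.prod I') p →L[ℝ] TangentSpace I' p.2 =>
        g'.inner p.2 (L v) (L v)) mfderiv_snd
    have h5 := mul_nonneg h2.le h4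
    exact ⟨lt_of_eq_of_lt e1.symm (by linarith),
      lt_of_eq_of_lt (congrArg (fun t => f p.1 ^ 2 * t) e2.symm) (by linarith)⟩
  contMDiff := by
    have h : ContMDiff (I.prod I') 𝓘(ℝ, ℝ) ∞ (fun p : M × M' => f p.1 ^ 2) :=
      (hf.comp contMDiff_fst).pow 2
    exact contMDiff_add_smul_form (contMDiff_pullbackForm g contMDiff_fst) h
      (contMDiff_pullbackForm g' contMDiff_snd)

end General

/-- The standard Euclidean metric `∑ dx_i²` of `ℝⁿ`. -/
def euclideanMetric (n : ℕ) : RiemMetric (𝓡 n) (EuclideanSpace ℝ (Fin n)) :=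
  { riemannianMetricVectorSpace (EuclideanSpace ℝ (Fin n)) with
    contMDiff := (riemannianMetricVectorSpace (EuclideanSpace ℝ (Fin n))).contMDiff.of_le le_top }

/-- `φ = φ(ξ)` with `ξ = ∑ α_i x_i`, i.e. `φ` is invariant under the translations along the
hyperplane `ξ = 0`. -/
def DependsOnLinear {n : ℕ} (α : Fin n → ℝ) (φ : EuclideanSpace ℝ (Fin n) → ℝ) : Prop :=
  ∃ Φ : ℝ → ℝ, ∀ x, φ x = Φ (∑ i, α i * x i)

/-- `φ = φ(r)` with `r = ∑ x_i²`, i.e. `φ` is invariant under rotations. -/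
def DependsOnRadius {n : ℕ} (φ : EuclideanSpace ℝ (Fin n) → ℝ) : Prop :=
  ∃ Φ : ℝ → ℝ, ∀ x, φ x = Φ (∑ i, x i ^ 2)

section Ricci

/-! The Ricci tensor of a metric, written in the coordinates `y_1, …, y_m` given by the chart of the
manifold at `x₀`. -/

variable {m : ℕ} {M : Type*} [TopologicalSpace M] [ChartedSpace (EuclideanSpace ℝ (Fin m)) M]
  [IsManifold (𝓡 m) ∞ M]

/-- The coordinate vector field `∂_i` at the point with coordinates `y`. -/
def coordVector (x₀ : M) (y : EuclideanSpace ℝ (Fin m)) (i : Fin m) :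
    TangentSpace (𝓡 m) ((extChartAt (𝓡 m) x₀).symm y) :=
  mfderiv (𝓡 m) (𝓡 m) (extChartAt (𝓡 m) x₀).symm y (EuclideanSpace.single i (1 : ℝ))

/-- The matrix `g_ij = g(∂_i, ∂_j)`. -/
def gramMatrix (g : RiemMetric (𝓡 m) M) (x₀ : M) (y : EuclideanSpace ℝ (Fin m)) :
    Matrix (Fin m) (Fin m) ℝ :=
  Matrix.of fun i j => g.inner ((extChartAt (𝓡 m) x₀).symm y) (coordVector x₀ y i)
    (coordVector x₀ y j)

/-- The partial derivative `∂h/∂y_i`. -/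
def partialDeriv (i : Fin m) (h : EuclideanSpace ℝ (Fin m) → ℝ) (y : EuclideanSpace ℝ (Fin m)) :
    ℝ :=
  fderiv ℝ h y (EuclideanSpace.single i (1 : ℝ))

/-- The Christoffel symbol `Γ^k_ij = ½ ∑_l g^kl (∂_i g_jl + ∂_j g_il - ∂_l g_ij)`. -/
def christoffel (g : RiemMetric (𝓡 m) M) (x₀ : M) (k i j : Fin m)
    (y : EuclideanSpace ℝ (Fin m)) : ℝ :=
  (1 / 2) * ∑ l, (gramMatrix g x₀ y)⁻¹ k l *
    (partialDeriv i (fun z => gramMatrix g x₀ z j l) y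
      + partialDeriv j (fun z => gramMatrix g x₀ z i l) y
      - partialDeriv l (fun z => gramMatrix g x₀ z i j) y)

/-- The component
`Ric_ij = ∑_k (∂_k Γ^k_ij - ∂_j Γ^k_ik) + ∑_{k,l} (Γ^k_kl Γ^l_ij - Γ^k_jl Γ^l_ik)`
of the Ricci tensor. -/
def ricciCoeff (g : RiemMetric (𝓡 m) M) (x₀ : M) (i j : Fin m)
    (y : EuclideanSpace ℝ (Fin m)) : ℝ :=
  ∑ k, (partialDeriv k (christoffel g x₀ k i j) y - partialDeriv j (christoffel g x₀ k i k) y)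
    + ∑ k, ∑ l, (christoffel g x₀ k k l y * christoffel g x₀ l i j y
      - christoffel g x₀ k j l y * christoffel g x₀ l i k y)

/-- The metric `g` is Ricci-flat. -/
def IsRicciFlat (g : RiemMetric (𝓡 m) M) : Prop :=
  ∀ x₀ : M, ∀ y ∈ (extChartAt (𝓡 m) x₀).target, ∀ i j : Fin m, ricciCoeff g x₀ i j y = 0

end Ricci

end RicciAlmostSoliton

end

noncomputable section

namespace RicciAlmostSoliton

open MeasureTheory

/-! ### Riemannian distances and Lipschitz maps -/

section Distance

variable {E : Type*} [NormedAddCommGroup E] [NormedSpace ℝ E]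
  {H : Type*} [TopologicalSpace H] {I : ModelWithCorners ℝ E H}
  {M : Type*} [TopologicalSpace M] [ChartedSpace H M] [IsManifold I ∞ M]
  {E' : Type*} [NormedAddCommGroup E'] [NormedSpace ℝ E']
  {H' : Type*} [TopologicalSpace H'] {I' : ModelWithCorners ℝ E' H'}
  {M' : Type*} [TopologicalSpace M'] [ChartedSpace H' M'] [IsManifold I' ∞ M']

/-! The bound `|φ| ≤ c` says that lengths for `φ⁻² g` are at least `1 / c` times Euclidean lengths.
A Cauchy sequence for `φ⁻² g` is therefore Cauchy in `ℝⁿ` and has a Euclidean limit. No reverse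
global inequality is needed to return to `φ⁻² g`: convergence in the manifold topology implies
convergence for any Riemannian distance (`RiemMetric.tendsto_distance`).

In the warped product, the projection to the base is 1-Lipschitz, and the projection to the fibre is
`c`-Lipschitz because `|f| = 1 / |φ| ≥ 1 / c`. So both components of a Cauchy sequence converge, say
to `x` and `y`. A horizontal move followed by a move inside the fibre over `x` bounds the distance
to `(x, y)`.

Each comparison of distances applies `RiemMetric.distance_map_le` to an identity, a projection or
the inclusion of a slice. -/

theorem RiemMetric.distance_comm (g : RiemMetric I M) (x y : M) :
    g.distance x y = g.distance y x := by
  let : RiemannianBundle (fun x : M => TangentSpace I x) := ⟨g.toRiemannianMetric⟩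
  exact riemannianEDist_comm

theorem RiemMetric.distance_triangle (g : RiemMetric I M) (x y z : M) :
    g.distance x z ≤ g.distance x y + g.distance y z := by
  let : RiemannianBundle (fun x : M => TangentSpace I x) := ⟨g.toRiemannianMetric⟩
  exact riemannianEDist_triangle

/-- The Riemannian distance to `x` tends to `0` at `x` for the topology of the manifold. -/
theorem RiemMetric.tendsto_distance (g : RiemMetric I M) (x : M) :
    Tendsto (fun y => g.distance y x) (𝓝 x) (𝓝 0) := by
  let : RiemannianBundle (fun x : M => TangentSpace I x) := ⟨g.toRiemannianMetric⟩
  have : IsManifold I 1 M := IsManifold.of_le (n := ∞) (by simp)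
  have : IsContinuousRiemannianBundle E (fun x : M => TangentSpace I x) :=
    ⟨⟨g.inner, g.contMDiff.continuous, fun _ _ _ => rfl⟩⟩
  simp only [g.distance_comm _ x]
  rw [ENNReal.tendsto_nhds_zero]
  intro ε hε
  exact (eventually_riemannianEDist_lt I x hε).mono fun y hy => hy.le

/-- A smooth map whose differential scales lengths by at most `K` is `K`-Lipschitz for the
Riemannian distances. -/
theorem RiemMetric.distance_map_le (g : RiemMetric I M) (g' : RiemMetric I' M') {q : M → M'}
    (hq : ContMDiff I I' ∞ q) {K : ℝ} (hK₀ : 0 < K)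
    (hK : ∀ p (v : TangentSpace I p),
      g'.inner (q p) (mfderiv I I' q p v) (mfderiv I I' q p v) ≤ K ^ 2 * g.inner p v v)
    (x y : M) : g'.distance (q x) (q y) ≤ ENNReal.ofReal K * g.distance x y := by
  let : RiemannianBundle (fun x : M => TangentSpace I x) := ⟨g.toRiemannianMetric⟩
  let : RiemannianBundle (fun x : M' => TangentSpace I' x) := ⟨g'.toRiemannianMetric⟩
  have hnorm : ∀ p (v : TangentSpace I p),
      ‖mfderiv I I' q p v‖ₑ ≤ ENNReal.ofReal K * ‖v‖ₑ := by
    intro p v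
    have h : ‖mfderiv I I' q p v‖ ≤ K * ‖v‖ := by
      rw [norm_eq_sqrt_real_inner, norm_eq_sqrt_real_inner]
      calc _ ≤ √(K ^ 2 * g.inner p v v) := Real.sqrt_le_sqrt (hK p v)
        _ = K * √(g.inner p v v) := by
          rw [Real.sqrt_mul (by positivity), Real.sqrt_sq hK₀.le]
    rw [← ofReal_norm, ← ofReal_norm, ← ENNReal.ofReal_mul hK₀.le]
    exact ENNReal.ofReal_le_ofReal h
  change riemannianEDist I' (q x) (q y) ≤ ENNReal.ofReal K * riemannianEDist I x y
  have hK₁ : ENNReal.ofReal K ≠ 0 := by simpa using hK₀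
  -- With `K` moved to the left, the right side is the bare infimum, which is approached by the
  -- lengths of actual paths.
  rw [mul_comm, ← ENNReal.div_le_iff_le_mul (.inl hK₁) (.inl ENNReal.ofReal_ne_top)]
  refine le_of_forall_gt fun r hr => ?_
  -- This path is `C^1` on all of `ℝ`, so the chain rule below also holds at the endpoints `0` and
  -- `1`.
  obtain ⟨γ, hγx, hγy, hγ, hγr, -⟩ := exists_lt_locally_constant_of_riemannianEDist_lt hr zero_lt_one
  refine lt_of_le_of_lt ?_ hγr
  rw [ENNReal.div_le_iff_le_mul (.inl hK₁) (.inl ENNReal.ofReal_ne_top), mul_comm]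
  have hq1 : ContMDiff I I' 1 q := hq.of_le (by simp)
  calc riemannianEDist I' (q x) (q y) ≤ pathELength I' (q ∘ γ) 0 1 :=
        riemannianEDist_le_pathELength (hq1.comp hγ).contMDiffOn (by simp [hγx]) (by simp [hγy])
          zero_le_one
    _ ≤ ENNReal.ofReal K * pathELength I γ 0 1 := by
      rw [pathELength_eq_lintegral_mfderiv_Icc, pathELength_eq_lintegral_mfderiv_Icc,
        ← lintegral_const_mul' _ _ ENNReal.ofReal_ne_top]
      refine lintegral_mono fun t => ?_
      have hc : mfderiv 𝓘(ℝ, ℝ) I' (q ∘ γ) t (1 : ℝ)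
          = mfderiv I I' q (γ t) (mfderiv 𝓘(ℝ, ℝ) I γ t (1 : ℝ)) := by
        rw [mfderiv_comp t (hq1.mdifferentiable one_ne_zero _) (hγ.mdifferentiable one_ne_zero t)]
        rfl
      exact (congrArg (fun v : TangentSpace I' (q (γ t)) => ‖v‖ₑ) hc).trans_le (hnorm _ _)

end Distance

/-- A sequence that is Cauchy for `d` is Cauchy for every `d'` bounded by a multiple of `d`. -/
theorem cauchy_of_le_mul {d d' : ℕ → ℕ → ℝ≥0∞} {K : ℝ≥0∞} (hK : K ≠ ⊤)
    (hd : ∀ ε : ℝ≥0∞, 0 < ε → ∃ N : ℕ, ∀ k ≥ N, ∀ l ≥ N, d k l < ε)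
    (h : ∀ k l, d' k l ≤ K * d k l) (ε : ℝ≥0∞) (hε : 0 < ε) :
    ∃ N : ℕ, ∀ k ≥ N, ∀ l ≥ N, d' k l < ε := by
  obtain ⟨N, hN⟩ := hd (ε / K) (ENNReal.div_pos hε.ne' hK)
  refine ⟨N, fun k hk l hl => (h k l).trans_lt ?_⟩
  rw [mul_comm]
  exact ENNReal.mul_lt_of_lt_div (hN k hk l hl)

theorem distance_euclideanMetric {n : ℕ} (x y : EuclideanSpace ℝ (Fin n)) :
    (euclideanMetric n).distance x y = edist x y :=
  (IsRiemannianManifold.out (I := 𝓡 n) x y).symm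

/-! ### Comparison of distances for conformal and warped product metrics -/

section Warped

variable {E : Type*} [NormedAddCommGroup E] [NormedSpace ℝ E]
  {H : Type*} [TopologicalSpace H] {I : ModelWithCorners ℝ E H}
  {M : Type*} [TopologicalSpace M] [ChartedSpace H M] [IsManifold I ∞ M]
  {E' : Type*} [NormedAddCommGroup E'] [NormedSpace ℝ E']
  {H' : Type*} [TopologicalSpace H'] {I' : ModelWithCorners ℝ E' H'}
  {M' : Type*} [TopologicalSpace M'] [ChartedSpace H' M'] [IsManifold I' ∞ M']

theorem distance_le_conformalMetric (g : RiemMetric I M) {φ : M → ℝ}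
    (hφ : ContMDiff I 𝓘(ℝ, ℝ) ∞ φ) (hφ₀ : ∀ p, φ p ≠ 0) {c : ℝ} (hc : 0 < c)
    (hφc : ∀ p, |φ p| ≤ c) (x y : M) :
    g.distance x y ≤ ENNReal.ofReal c * (conformalMetric g φ hφ hφ₀).distance x y := by
  refine RiemMetric.distance_map_le _ _ (q := id) contMDiff_id hc (fun p v => ?_) x y
  have hv : 0 ≤ g.inner p v v := by
    rcases eq_or_ne v 0 with rfl | h
    · simp
    · exact (g.pos p v h).le
  have hp : 0 < φ p ^ 2 := by have := hφ₀ p; positivity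
  have h : φ p ^ 2 ≤ c ^ 2 := sq_le_sq.2 ((hφc p).trans (le_abs_self c))
  rw [mfderiv_id]
  change g.inner p v v ≤ c ^ 2 * (1 / φ p ^ 2 * g.inner p v v)
  rw [← mul_assoc, mul_one_div]
  exact le_mul_of_one_le_left hv ((one_le_div hp).2 h)

variable (g : RiemMetric I M) (g' : RiemMetric I' M') {f : M → ℝ}
  (hf : ContMDiff I 𝓘(ℝ, ℝ) ∞ f) (hf₀ : ∀ p, f p ≠ 0)

theorem distance_fst_le (p p' : M × M') :
    g.distance p.1 p'.1 ≤ (warpedProductMetric g g' f hf hf₀).distance p p' := by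
  refine (RiemMetric.distance_map_le (warpedProductMetric g g' f hf hf₀) g
    (q := Prod.fst) contMDiff_fst one_pos (fun p v => ?_) p p').trans_eq (by simp)
  change pullbackForm (I := I.prod I') g Prod.fst p v v ≤
    1 ^ 2 * (pullbackForm (I := I.prod I') g Prod.fst p v v +
      f p.1 ^ 2 * pullbackForm (I := I.prod I') g' Prod.snd p v v)
  have h := mul_nonneg (sq_nonneg (f p.1)) (pullbackForm_nonneg (I := I.prod I') g' Prod.snd p v)
  linarith

/-- The fibre term of the metric carries the factor `f²`, and `c² f² ≥ 1`. -/
theorem distance_snd_le {c : ℝ} (hc : 0 < c) (hfc : ∀ p, 1 ≤ c * |f p|) (p p' : M × M') :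
    g'.distance p.2 p'.2 ≤
      ENNReal.ofReal c * (warpedProductMetric g g' f hf hf₀).distance p p' := by
  refine RiemMetric.distance_map_le (warpedProductMetric g g' f hf hf₀) g'
    (q := Prod.snd) contMDiff_snd hc (fun p v => ?_) p p'
  change pullbackForm (I := I.prod I') g' Prod.snd p v v ≤
    c ^ 2 * (pullbackForm (I := I.prod I') g Prod.fst p v v +
      f p.1 ^ 2 * pullbackForm (I := I.prod I') g' Prod.snd p v v)
  have h₁ := mul_nonneg (sq_nonneg c) (pullbackForm_nonneg (I := I.prod I') g Prod.fst p v)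
  have h₂ : 1 ≤ c ^ 2 * f p.1 ^ 2 := by
    rw [← sq_abs (f p.1), ← mul_pow]
    exact one_le_pow₀ (hfc p.1)
  nlinarith [pullbackForm_nonneg (I := I.prod I') g' Prod.snd p v]

theorem distance_prodMk_left_le (x x' : M) (y : M') :
    (warpedProductMetric g g' f hf hf₀).distance (x, y) (x', y) ≤ g.distance x x' := by
  refine (RiemMetric.distance_map_le g (warpedProductMetric g g' f hf hf₀)
    (q := fun x => (x, y)) (contMDiff_id.prodMk contMDiff_const) one_pos
    (fun p v => ?_) x x').trans_eq (by simp)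
  rw [mfderiv_prod_left]
  -- The differential of the inclusion is `v ↦ (v, 0)`, so only the base term survives.
  change g.inner p (mfderiv (I.prod I') I Prod.fst (p, y) ((v, 0) : E × E'))
      (mfderiv (I.prod I') I Prod.fst (p, y) ((v, 0) : E × E')) +
    f p ^ 2 * g'.inner y (mfderiv (I.prod I') I' Prod.snd (p, y) ((v, 0) : E × E'))
      (mfderiv (I.prod I') I' Prod.snd (p, y) ((v, 0) : E × E')) ≤ 1 ^ 2 * g.inner p v v
  rw [mfderiv_fst, mfderiv_snd]
  change g.inner p v v + f p ^ 2 * g'.inner y 0 0 ≤ _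
  simp

/-- The base point is fixed along the slice, so `f` is the constant `f x` there and no upper bound
on `f` is needed. -/
theorem distance_prodMk_right_le (x : M) (y y' : M') :
    (warpedProductMetric g g' f hf hf₀).distance (x, y) (x, y') ≤
      ENNReal.ofReal |f x| * g'.distance y y' := by
  refine RiemMetric.distance_map_le g' (warpedProductMetric g g' f hf hf₀)
    (q := fun y => (x, y)) (contMDiff_const.prodMk contMDiff_id) (abs_pos.2 (hf₀ x))
    (fun p v => ?_) y y'
  rw [mfderiv_prod_right]
  change g.inner x (mfderiv (I.prod I') I Prod.fst (x, p) ((0, v) : E × E'))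
      (mfderiv (I.prod I') I Prod.fst (x, p) ((0, v) : E × E')) +
    f x ^ 2 * g'.inner p (mfderiv (I.prod I') I' Prod.snd (x, p) ((0, v) : E × E'))
      (mfderiv (I.prod I') I' Prod.snd (x, p) ((0, v) : E × E')) ≤ |f x| ^ 2 * g'.inner p v v
  rw [mfderiv_fst, mfderiv_snd]
  change g.inner x 0 0 + f x ^ 2 * g'.inner p v v ≤ _
  simp

/-- A warped product of complete metrics is complete if the warping function is bounded below. -/
theorem isComplete_warpedProductMetric (hg : g.IsComplete) (hg' : g'.IsComplete) {c : ℝ}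
    (hc : 0 < c) (hfc : ∀ p, 1 ≤ c * |f p|) :
    (warpedProductMetric g g' f hf hf₀).IsComplete := by
  intro u hu
  obtain ⟨x, hx⟩ := hg (fun k => (u k).1) fun ε hε => by
    obtain ⟨N, hN⟩ := hu ε hε
    exact ⟨N, fun k hk l hl => (distance_fst_le g g' hf hf₀ _ _).trans_lt (hN k hk l hl)⟩
  obtain ⟨y, hy⟩ := hg' (fun k => (u k).2)
    (cauchy_of_le_mul ENNReal.ofReal_ne_top hu fun _ _ => distance_snd_le g g' hf hf₀ hc hfc _ _)
  refine ⟨(x, y), ?_⟩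
  -- The limit of the second distance is `0`, so multiplying by a constant preserves it only when
  -- the constant is finite.
  have h := hx.add (ENNReal.Tendsto.const_mul hy (.inr (ENNReal.ofReal_ne_top (r := |f x|))))
  rw [mul_zero, add_zero] at h
  refine tendsto_of_tendsto_of_tendsto_of_le_of_le tendsto_const_nhds h (fun _ => zero_le)
    fun k => ?_
  -- The base coordinate moves first: the fibre move then takes place over `x`, with the factor `|f
  -- x|` independent of `k`.
  exact (RiemMetric.distance_triangle _ (u k) (x, (u k).2) (x, y)).trans
    (add_le_add (distance_prodMk_left_le g g' hf hf₀ _ _ _)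
      (distance_prodMk_right_le g g' hf hf₀ _ _ _))

end Warped

/-! ### Completeness of bounded conformal factors and the final statement -/

theorem isComplete_conformalMetric_euclideanMetric {n : ℕ} {φ : EuclideanSpace ℝ (Fin n) → ℝ}
    (hφ : ContMDiff (𝓡 n) 𝓘(ℝ, ℝ) ∞ φ) (hφ₀ : ∀ x, φ x ≠ 0) {c : ℝ} (hc : 0 < c)
    (hφc : ∀ x, |φ x| ≤ c) : (conformalMetric (euclideanMetric n) φ hφ hφ₀).IsComplete := by
  intro u hu
  have hu' := cauchy_of_le_mul (ENNReal.ofReal_ne_top (r := c)) hu fun k l =>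
    distance_le_conformalMetric (euclideanMetric n) hφ hφ₀ hc hφc (u k) (u l)
  simp only [distance_euclideanMetric] at hu'
  obtain ⟨x, hx⟩ := cauchySeq_tendsto_of_complete (EMetric.cauchySeq_iff.2 fun ε hε => hu' ε hε)
  -- The factor `1 / φ²` may be unbounded, so the way back is topological rather than by a Lipschitz
  -- bound.
  exact ⟨x, (RiemMetric.tendsto_distance _ x).comp hx⟩

end RicciAlmostSoliton

end

theorem corollary1p4 (n : ℕ) (hn : 3 ≤ n)
    (φ : EuclideanSpace ℝ (Fin n) → ℝ) (hφ : ContMDiff (𝓡 n) 𝓘(ℝ, ℝ) ∞ φ)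
    (hφ₀ : ∀ x, φ x ≠ 0) (hφb : ∃ c : ℝ, ∀ x, |φ x| ≤ c) :
    -- the metrics `φ⁻² g` with `φ = φ(ξ)`
    (∀ α : Fin n → ℝ, RicciAlmostSoliton.DependsOnLinear α φ →
      (RicciAlmostSoliton.conformalMetric
        (RicciAlmostSoliton.euclideanMetric n) φ hφ hφ₀).IsComplete) ∧
    -- the warped products `φ⁻² g + f² g_F` with `φ = φ(ξ)` and `f = 1 / φ`
    (∀ α : Fin n → ℝ, RicciAlmostSoliton.DependsOnLinear α φ →
      ∀ (m : ℕ) (F : Type*) [TopologicalSpace F] [ChartedSpace (EuclideanSpace ℝ (Fin m)) F]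
        [IsManifold (𝓡 m) ∞ F] [T2Space F] (gF : RicciAlmostSoliton.RiemMetric (𝓡 m) F),
        RicciAlmostSoliton.IsRicciFlat gF → gF.IsComplete →
        ∀ (f : EuclideanSpace ℝ (Fin n) → ℝ) (hf : ContMDiff (𝓡 n) 𝓘(ℝ, ℝ) ∞ f)
          (hf₀ : ∀ x, f x ≠ 0), (∀ x, f x = 1 / φ x) →
          (RicciAlmostSoliton.warpedProductMetric
            (RicciAlmostSoliton.conformalMetric
              (RicciAlmostSoliton.euclideanMetric n) φ hφ hφ₀) gF f hf hf₀).IsComplete) ∧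
    -- the metrics `φ⁻² g` with `φ = φ(r)`
    (RicciAlmostSoliton.DependsOnRadius φ →
      (RicciAlmostSoliton.conformalMetric
        (RicciAlmostSoliton.euclideanMetric n) φ hφ hφ₀).IsComplete) := by
  obtain ⟨c, hc⟩ := hφb
  have hc₀ : 0 < c := (abs_pos.2 (hφ₀ 0)).trans_le (hc 0)
  have h := RicciAlmostSoliton.isComplete_conformalMetric_euclideanMetric hφ hφ₀ hc₀ hc
  refine ⟨fun _ _ => h, ?_, fun _ => h⟩
  intro _ _ m F _ _ _ _ gF _ hgF f hf hf₀ hfφ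
  refine RicciAlmostSoliton.isComplete_warpedProductMetric _ gF hf hf₀ h hgF hc₀ fun x => ?_
  -- The same `c` serves for `f`: the claim `1 ≤ c * |f x|` becomes `1 ≤ c / |φ x|`.
  rw [hfφ x, abs_div, abs_one, mul_one_div]
  exact (one_le_div (abs_pos.2 (hφ₀ x))).2 (hc x)
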